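/- Let $K$ be a field of arbitrary characteristic. For a Lie algebra $L$ over $K$, of finite or infinite dimension, let $U(L)$ be its universal enveloping algebra. The cohomological dimension $\operatorname{cd}(L)\in\{0,1,2,\dots\}\cup\{\infty\}$ is the projective dimension of the trivial module $K$ (on which $L$ acts by zero) in the category of all right $U(L)$-modules, that is, the minimal length $n$ of a finite resolution $0\to P_n\to\dots\to P_1\to P_0\to K\to 0$ by projective right $U(L)$-modules, and $\infty$ if no finite projective resolution exists. Then: (i) if $L$ is an abelian Lie algebra over $K$, then $\operatorname{cd}(L)=\dim_K L$, where both sides are read as $\infty$ when $L$ is infinite-dimensional; (ii) if $L$ is a nonabelian Lie algebra over $K$ with $\dim_K L=2$, then $\operatorname{cd}(L)=2$; (iii) if $L$ is a Lie algebra over $K$ with $\operatorname{cd}(L)=1$, then $L$ has no subalgebra of dimension $2$ over $K$. -/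

import Mathlib

universe u v

namespace LieCohomologicalDimension

open CategoryTheory

section

attribute [local instance] LieRing.ofAssociativeRing

/-- The augmentation `U(L) → K` of the universal enveloping algebra: the algebra homomorphism
that sends every element of `L` to `0`. -/
noncomputable def augmentation (K : Type u) (L : Type v) [Field K] [LieRing L] [LieAlgebra K L] :
    UniversalEnvelopingAlgebra K L →ₐ[K] K :=
  UniversalEnvelopingAlgebra.lift K (0 : L →ₗ⁅K⁆ K)

theorem augmentation_ι (K : Type u) (L : Type v) [Field K] [LieRing L] [LieAlgebra K L] (x : L) :
    augmentation K L (UniversalEnvelopingAlgebra.ι K x) = 0 := by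
  simp [augmentation]

end

/-- The underlying type of the trivial one-dimensional `L`-module `K`, moved to the universe of
`U(L)`. -/
@[reducible]
def TrivialModule (K : Type u) (_L : Type v) : Type (max u v) := ULift.{v} K

/-- The trivial `L`-module `K` as a right `U(L)`-module, that is, as a module over `U(L)ᵐᵒᵖ`:
`U(L)` acts through the augmentation. -/
@[reducible]
noncomputable def trivialModuleStructure (K : Type u) (L : Type v) [Field K] [LieRing L]
    [LieAlgebra K L] : Module (UniversalEnvelopingAlgebra K L)ᵐᵒᵖ (TrivialModule K L) :=
  Module.compHom (TrivialModule K L)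
    ((augmentation K L).toRingHom.fromOpposite fun _ _ => mul_comm _ _)

/-- The trivial `L`-module `K` as an object of the category of right `U(L)`-modules. -/
noncomputable def trivialRightModule (K : Type u) (L : Type v) [Field K] [LieRing L]
    [LieAlgebra K L] : ModuleCat.{max u v} (UniversalEnvelopingAlgebra K L)ᵐᵒᵖ :=
  letI := trivialModuleStructure K L
  ModuleCat.of (UniversalEnvelopingAlgebra K L)ᵐᵒᵖ (TrivialModule K L)

/-- The cohomological dimension of a Lie algebra `L` over a field `K`: the projective dimension
of the trivial module `K` in the category of all right modules over `U(L)`. The value is `⊤` when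
there is no projective resolution of finite length; it is never `⊥`, since `K ≠ 0`. -/
noncomputable def cd (K : Type u) (L : Type v) [Field K] [LieRing L] [LieAlgebra K L] :
    WithBot ℕ∞ :=
  projectiveDimension (trivialRightModule K L)

end LieCohomologicalDimension

-- The principal anti-automorphism of U(L) fixes the augmentation, so `cd` may be computed with left
-- modules. Lower bound: let x, y be independent in L with [x, y] = a y. In U(L), y is left
-- cancellable and x - a is regular on U(L)/yU(L). If `cd` were at most 1, the augmentation ideal I
-- would be projective, hence a summand of a free module through some section s. Applying s to (x -
-- a) y = y x shows that every coordinate of s(y) lies in yU(L); so y = y m with m in I, and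
-- cancelling y gives 1 ∈ I, which is absurd (`not_projective_ker`). Every two-dimensional Lie
-- algebra contains such a pair, so a two-dimensional subalgebra forces `cd` ≥ 2. If x, y span L,
-- the same regularity on the other side gives a resolution 0 → U → U² → U → K → 0
-- (`hasProjectiveDimensionLT_three`). The regularity comes from Poincaré–Birkhoff–Witt: U(L) acts
-- on the polynomials in an ordered basis beginning with y, x, and u is recovered from u·1. There y
-- acts as multiplication by its variable, and x as multiplication by its variable modulo that of y.
-- For abelian L, U(L) is a polynomial ring. With finitely many variables these form a regular
-- sequence with quotient K, which bounds the dimension above and gives a nonzero top Ext(K, K).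
-- With infinitely many, restriction to a polynomial subring in n + 1 variables excludes dimension
-- n.

universe w w'

/-! ### Poincaré–Birkhoff–Witt: the representation of U(L) on polynomials. -/

namespace PoincareBirkhoffWitt

open MvPolynomial Module

variable {K : Type u} {L : Type v} {σ : Type w} [Field K] [LieRing L] [LieAlgebra K L]

section Filtration

variable (K σ) in
/-- The polynomials of degree at most `n`. -/
noncomputable def degreeLE (n : ℕ) : Submodule K (MvPolynomial σ K) :=
  Submodule.span K ((fun M => monomial M (1 : K)) '' {M : σ →₀ ℕ | M.degree ≤ n})

theorem monomial_mem_degreeLE {M : σ →₀ ℕ} {n : ℕ} (h : M.degree ≤ n) :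
    monomial M (1 : K) ∈ degreeLE K σ n :=
  Submodule.subset_span ⟨M, h, rfl⟩

theorem degreeLE_mono {m n : ℕ} (h : m ≤ n) : degreeLE K σ m ≤ degreeLE K σ n :=
  Submodule.span_mono (Set.image_mono fun _ hM => le_trans (Set.mem_ofPred.1 hM) h)

theorem degreeLE_induction {n : ℕ} {p : ∀ f, f ∈ degreeLE K σ n → Prop}
    (mono : ∀ (M : σ →₀ ℕ) (hM : M.degree ≤ n), p (monomial M 1) (monomial_mem_degreeLE hM))
    (zero : p 0 (zero_mem _))
    (add : ∀ f g hf hg, p f hf → p g hg → p (f + g) (add_mem hf hg))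
    (smul : ∀ (c : K) f hf, p f hf → p (c • f) (Submodule.smul_mem _ c hf))
    {f : MvPolynomial σ K} (hf : f ∈ degreeLE K σ n) : p f hf := by
  induction hf using Submodule.span_induction with
  | mem x hx => obtain ⟨M, hM, rfl⟩ := hx; exact mono M hM
  | zero => exact zero
  | add f g _ _ hf hg => exact add f g _ _ hf hg
  | smul c f _ hf => exact smul c f _ hf

theorem exists_mem_degreeLE (f : MvPolynomial σ K) : ∃ n, f ∈ degreeLE K σ n := by
  induction f using MvPolynomial.induction_on' with
  | monomial M c =>
    refine ⟨M.degree, ?_⟩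
    rw [← mul_one c, ← smul_eq_mul, ← smul_monomial]
    exact Submodule.smul_mem _ _ (monomial_mem_degreeLE le_rfl)
  | add f g hf hg =>
    obtain ⟨m, hm⟩ := hf
    obtain ⟨n, hn⟩ := hg
    exact ⟨max m n, add_mem (degreeLE_mono (le_max_left _ _) hm)
      (degreeLE_mono (le_max_right _ _) hn)⟩

theorem X_mul_monomial (i : σ) (M : σ →₀ ℕ) :
    X i * monomial M (1 : K) = monomial (M + Finsupp.single i 1) 1 := by
  rw [mul_comm, X, monomial_mul, mul_one]

theorem X_mul_mem_degreeLE (i : σ) {n : ℕ} {f : MvPolynomial σ K} (hf : f ∈ degreeLE K σ n) :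
    X i * f ∈ degreeLE K σ (n + 1) := by
  induction hf using degreeLE_induction with
  | mono M hM =>
    rw [X_mul_monomial]
    exact monomial_mem_degreeLE (by simpa using hM)
  | zero => simp
  | add f g _ _ hf hg => rw [mul_add]; exact add_mem hf hg
  | smul c f _ hf => rw [mul_smul_comm]; exact Submodule.smul_mem _ _ hf

end Filtration

section Action

theorem basis_induction (b : Basis σ K L) {p : L → Prop} (basis : ∀ i, p (b i)) (zero : p 0)
    (add : ∀ x y, p x → p y → p (x + y)) (smul : ∀ (c : K) x, p x → p (c • x)) (x : L) : p x := by
  induction b.mem_span x using Submodule.span_induction with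
  | mem x hx => obtain ⟨i, rfl⟩ := hx; exact basis i
  | zero => exact zero
  | add x y _ _ hx hy => exact add x y hx hy
  | smul c x _ hx => exact smul c x hx

/-- The operators which agree up to lower terms with multiplication by variables raise the degree
by at most one. -/
theorem apply_mem_degreeLE (b : Basis σ K L) {A : L →ₗ[K] End K (MvPolynomial σ K)} {n : ℕ}
    (hA : ∀ i (M : σ →₀ ℕ), M.degree ≤ n → A (b i) (monomial M 1) - X i * monomial M 1 ∈
      degreeLE K σ M.degree) (x : L) {f : MvPolynomial σ K} (hf : f ∈ degreeLE K σ n) :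
    A x f ∈ degreeLE K σ (n + 1) := by
  induction x using basis_induction b with
  | basis i =>
    induction hf using degreeLE_induction with
    | mono M hM =>
      rw [← sub_add_cancel (A (b i) (monomial M 1)) (X i * monomial M 1)]
      exact add_mem (degreeLE_mono (by lia) (hA i M hM))
        (X_mul_mem_degreeLE i (monomial_mem_degreeLE hM))
    | zero => simp
    | add f g _ _ hf hg => rw [map_add]; exact add_mem hf hg
    | smul c f _ hf => rw [map_smul]; exact Submodule.smul_mem _ _ hf
  | zero => simp
  | add x y hx hy => rw [map_add, LinearMap.add_apply]; exact add_mem hx hy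
  | smul c x hx => rw [map_smul, LinearMap.smul_apply]; exact Submodule.smul_mem _ _ hx

variable [LinearOrder σ]

/-- `i` is at most every variable of the monomial `M`. -/
def LowerBound (i : σ) (M : σ →₀ ℕ) : Prop := ∀ j ∈ M.support, i ≤ j

theorem LowerBound.add_single {i j : σ} {M : σ →₀ ℕ} (h : LowerBound i M) (hij : i ≤ j) :
    LowerBound i (M + Finsupp.single j 1) := by
  intro k hk
  rcases Finset.mem_union.1 (Finsupp.support_add hk) with hk | hk
  · exact h k hk
  · rw [Finset.mem_singleton.1 (Finsupp.support_single_subset hk)]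
    exact hij

/-- Split off the least variable of M. `eq_of_add_single_eq` makes the splitting unique, so the
choices in `stepMonomial` are harmless. -/
theorem exists_eq_add_single_of_not_lowerBound {i : σ} {M : σ →₀ ℕ} (h : ¬ LowerBound i M) :
    ∃ j N, M = N + Finsupp.single j 1 ∧ j < i ∧ LowerBound j N := by
  simp only [LowerBound, not_forall, not_le] at h
  obtain ⟨k, hk, hki⟩ := h
  have hne : M.support.Nonempty := ⟨k, hk⟩
  have hmin := M.support.min'_mem hne
  have hle : Finsupp.single (M.support.min' hne) 1 ≤ M := by
    rw [Finsupp.single_le_iff]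
    exact Nat.one_le_iff_ne_zero.2 (Finsupp.mem_support_iff.1 hmin)
  refine ⟨M.support.min' hne, M - Finsupp.single (M.support.min' hne) 1, ?_, ?_, ?_⟩
  · rw [tsub_add_cancel_of_le hle]
  · exact lt_of_le_of_lt (M.support.min'_le k hk) hki
  · intro j hj
    exact M.support.min'_le j (Finsupp.support_mono tsub_le_self hj)

theorem not_lowerBound_add_single {i j : σ} (N : σ →₀ ℕ) (h : j < i) :
    ¬ LowerBound i (N + Finsupp.single j 1) := fun hi =>
  absurd (hi j (by simp)) (not_le.2 h)

theorem eq_of_add_single_eq {j k : σ} {N P : σ →₀ ℕ} (hj : LowerBound j N) (hk : LowerBound k P)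
    (h : N + Finsupp.single j 1 = P + Finsupp.single k 1) : j = k ∧ N = P := by
  have hjk : j = k := by
    refine le_antisymm ?_ ?_
    · exact (hj.add_single le_rfl) k (by rw [h]; simp)
    · exact (hk.add_single le_rfl) j (by rw [← h]; simp)
  subst hjk
  exact ⟨rfl, add_right_cancel h⟩

variable (b : Basis σ K L)

open Classical in
/-- One step of the recursion that computes the action of `b i` on a monomial. -/
noncomputable def stepMonomial (A : L →ₗ[K] End K (MvPolynomial σ K)) (i : σ) (M : σ →₀ ℕ) :
    MvPolynomial σ K :=
  if h : LowerBound i M then X i * monomial M 1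
  else
    let j := (exists_eq_add_single_of_not_lowerBound h).choose
    let N := (exists_eq_add_single_of_not_lowerBound h).choose_spec.choose
    -- This is forced by x_i x_j N = x_j x_i N + [x_i, x_j] N. The leading term X_i N of x_i N
    -- admits j as a lower bound, so x_j multiplies it; A is thus only evaluated in degree at most
    -- that of N.
    A (b j) (A (b i) (monomial N 1) - X i * monomial N 1) + X j * (X i * monomial N 1) +
      A ⁅b i, b j⁆ (monomial N 1)

theorem stepMonomial_of_lowerBound (A : L →ₗ[K] End K (MvPolynomial σ K)) {i : σ} {M : σ →₀ ℕ}
    (h : LowerBound i M) : stepMonomial b A i M = X i * monomial M 1 := dif_pos h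

theorem stepMonomial_add_single (A : L →ₗ[K] End K (MvPolynomial σ K)) {i j : σ} {N : σ →₀ ℕ}
    (hji : j < i) (hj : LowerBound j N) :
    stepMonomial b A i (N + Finsupp.single j 1) =
      A (b j) (A (b i) (monomial N 1) - X i * monomial N 1) + X j * (X i * monomial N 1) +
        A ⁅b i, b j⁆ (monomial N 1) := by
  have h := not_lowerBound_add_single N hji
  obtain ⟨h₁, -, h₂⟩ := (exists_eq_add_single_of_not_lowerBound h).choose_spec.choose_spec
  obtain ⟨e₁, e₂⟩ := eq_of_add_single_eq hj h₂ h₁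
  rw [stepMonomial, dif_neg h]
  have aux : ∀ j' N', j = j' → N = N' →
      A (b j') (A (b i) (monomial N' 1) - X i * monomial N' 1) + X j' * (X i * monomial N' 1) +
        A ⁅b i, b j'⁆ (monomial N' 1) =
      A (b j) (A (b i) (monomial N 1) - X i * monomial N 1) + X j * (X i * monomial N 1) +
        A ⁅b i, b j⁆ (monomial N 1) := by
    rintro _ _ rfl rfl
    rfl
  exact aux _ _ e₁ e₂

/-- The successive approximations of the action of `L` on polynomials. -/
noncomputable def stage : ℕ → (L →ₗ[K] End K (MvPolynomial σ K))
  | 0 => b.constr K fun i => LinearMap.mulLeft K (X i)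
  | n + 1 => b.constr K fun i => (basisMonomials σ K).constr K fun M =>
      stepMonomial b (stage n) i M

theorem stage_zero (i : σ) (f : MvPolynomial σ K) : stage b 0 (b i) f = X i * f := by
  simp [stage]

theorem stage_succ (n : ℕ) (i : σ) (M : σ →₀ ℕ) :
    stage b (n + 1) (b i) (monomial M 1) = stepMonomial b (stage b n) i M := by
  rw [stage, Basis.constr_basis, ← congrFun (coe_basisMonomials (σ := σ) (R := K)) M,
    Basis.constr_basis]

theorem stage_sub_mem (n : ℕ) (i : σ) (M : σ →₀ ℕ) :
    stage b n (b i) (monomial M 1) - X i * monomial M 1 ∈ degreeLE K σ M.degree := by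
  induction n generalizing i M with
  | zero => rw [stage_zero, sub_self]; exact zero_mem _
  | succ n ih =>
    rw [stage_succ]
    by_cases h : LowerBound i M
    · rw [stepMonomial_of_lowerBound b _ h, sub_self]
      exact zero_mem _
    · obtain ⟨j, N, rfl, hji, hj⟩ := exists_eq_add_single_of_not_lowerBound h
      rw [stepMonomial_add_single b _ hji hj, ← X_mul_monomial, mul_left_comm (X i),
        add_sub_right_comm, add_sub_cancel_right]
      have hd : (N + Finsupp.single j 1).degree = N.degree + 1 := by simp
      rw [hd]
      exact add_mem (apply_mem_degreeLE b (fun i M _ => ih i M) _ (ih i N))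
        (apply_mem_degreeLE b (fun i M _ => ih i M) _ (monomial_mem_degreeLE le_rfl))

/-- On monomials of degree n + 1 the recursion calls the previous stage only in degree at most n,
thanks to `stage_sub_mem`; so the stages stabilise degree by degree. -/
theorem stage_succ_eq (n : ℕ) (x : L) {f : MvPolynomial σ K} (hf : f ∈ degreeLE K σ n) :
    stage b (n + 1) x f = stage b n x f := by
  induction n generalizing x f with
  | zero =>
    induction x using basis_induction b with
    | basis i =>
      induction hf using degreeLE_induction with
      | mono M hM =>
        obtain rfl : M = 0 := by simpa [Finsupp.degree_eq_zero_iff] using hM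
        rw [stage_succ, stage_zero, stepMonomial_of_lowerBound]
        intro j hj
        simp at hj
      | zero => simp
      | add f g _ _ hf hg => rw [map_add, map_add, hf, hg]
      | smul c f _ hf => rw [map_smul, map_smul, hf]
    | zero => simp
    | add x y hx hy => simp only [map_add, LinearMap.add_apply, hx, hy]
    | smul c x hx => simp only [map_smul, LinearMap.smul_apply, hx]
  | succ n ih =>
    induction x using basis_induction b with
    | basis i =>
      induction hf using degreeLE_induction with
      | mono M hM =>
        rw [stage_succ, stage_succ]
        by_cases h : LowerBound i M
        · rw [stepMonomial_of_lowerBound b _ h, stepMonomial_of_lowerBound b _ h]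
        · obtain ⟨j, N, rfl, hji, hj⟩ := exists_eq_add_single_of_not_lowerBound h
          have hN : N.degree ≤ n := by simpa using hM
          rw [stepMonomial_add_single b _ hji hj, stepMonomial_add_single b _ hji hj,
            ih _ (monomial_mem_degreeLE hN), ih _ (monomial_mem_degreeLE hN),
            ih _ (degreeLE_mono hN (stage_sub_mem b n i N))]
      | zero => simp
      | add f g _ _ hf hg => rw [map_add, map_add, hf, hg]
      | smul c f _ hf => rw [map_smul, map_smul, hf]
    | zero => simp
    | add x y hx hy => simp only [map_add, LinearMap.add_apply, hx, hy]
    | smul c x hx => simp only [map_smul, LinearMap.smul_apply, hx]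

theorem stage_eq_of_le {m n : ℕ} (h : m ≤ n) (x : L) {f : MvPolynomial σ K}
    (hf : f ∈ degreeLE K σ m) : stage b n x f = stage b m x f := by
  induction n, h using Nat.le_induction with
  | base => rfl
  | succ n hmn ih => rw [stage_succ_eq b n x (degreeLE_mono hmn hf), ih]

/-- The action of `L` on polynomials in a basis of `L`. -/
noncomputable def action : L →ₗ[K] End K (MvPolynomial σ K) :=
  b.constr K fun i => (basisMonomials σ K).constr K fun M => stage b M.degree (b i) (monomial M 1)

theorem action_eq_stage {n : ℕ} (x : L) {f : MvPolynomial σ K} (hf : f ∈ degreeLE K σ n) :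
    action b x f = stage b n x f := by
  induction x using basis_induction b with
  | basis i =>
    induction hf using degreeLE_induction with
    | mono M hM =>
      rw [stage_eq_of_le b hM _ (monomial_mem_degreeLE le_rfl), action, Basis.constr_basis,
        ← congrFun (coe_basisMonomials (σ := σ) (R := K)) M, Basis.constr_basis,
        coe_basisMonomials]
    | zero => simp
    | add f g _ _ hf hg => rw [map_add, map_add, hf, hg]
    | smul c f _ hf => rw [map_smul, map_smul, hf]
  | zero => simp
  | add x y hx hy => simp only [map_add, LinearMap.add_apply, hx, hy]
  | smul c x hx => simp only [map_smul, LinearMap.smul_apply, hx]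

theorem action_sub_mem (i : σ) (M : σ →₀ ℕ) :
    action b (b i) (monomial M 1) - X i * monomial M 1 ∈ degreeLE K σ M.degree := by
  rw [action_eq_stage b _ (monomial_mem_degreeLE le_rfl)]
  exact stage_sub_mem b _ i M

theorem action_of_lowerBound {i : σ} {M : σ →₀ ℕ} (h : LowerBound i M) :
    action b (b i) (monomial M 1) = X i * monomial M 1 := by
  rw [action_eq_stage b _ (monomial_mem_degreeLE (Nat.le_succ _)), stage_succ,
    stepMonomial_of_lowerBound b _ h]

theorem action_X_mul {i j : σ} {N : σ →₀ ℕ} (hji : j < i) (hj : LowerBound j N) :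
    action b (b i) (X j * monomial N 1) =
      action b (b j) (action b (b i) (monomial N 1)) + action b ⁅b i, b j⁆ (monomial N 1) := by
  have h₁ : monomial (N + Finsupp.single j 1) 1 ∈ degreeLE K σ (N.degree + 1) :=
    monomial_mem_degreeLE (by simp)
  have h₂ : action b (b j) (X i * monomial N 1) = X j * (X i * monomial N 1) := by
    rw [X_mul_monomial, action_of_lowerBound b (hj.add_single hji.le)]
  rw [X_mul_monomial, action_eq_stage b _ h₁, stage_succ, stepMonomial_add_single b _ hji hj,
    ← action_eq_stage b _ (monomial_mem_degreeLE le_rfl),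
    ← action_eq_stage b _ (monomial_mem_degreeLE le_rfl),
    ← action_eq_stage b _ (action_sub_mem b i N), map_sub, h₂, sub_add_cancel]

/-- The action is compatible with brackets on polynomials of bounded degree. -/
theorem action_lie_aux (n : ℕ) (x y : L) {f : MvPolynomial σ K} (hf : f ∈ degreeLE K σ n) :
    action b x (action b y f) = action b y (action b x f) + action b ⁅x, y⁆ f := by
  induction n using Nat.strong_induction_on generalizing x y f with
  | _ n ih =>
  have key₁ : ∀ {i j : σ} {M : σ →₀ ℕ}, j < i → LowerBound j M →
      action b (b i) (action b (b j) (monomial M 1)) =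
        action b (b j) (action b (b i) (monomial M 1)) + action b ⁅b i, b j⁆ (monomial M 1) := by
    intro i j M hji hj
    rw [action_of_lowerBound b hj, action_X_mul b hji hj]
  have key₂ : ∀ {i j k : σ} {N : σ →₀ ℕ}, N.degree < n → k < i → k < j → LowerBound k N →
      action b (b i) (action b (b j) (X k * monomial N 1)) =
        action b (b k) (action b (b i) (action b (b j) (monomial N 1))) +
          action b ⁅b i, b k⁆ (action b (b j) (monomial N 1)) +
          action b ⁅b j, b k⁆ (action b (b i) (monomial N 1)) +
          action b ⁅b i, ⁅b j, b k⁆⁆ (monomial N 1) := by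
    intro i j k N hN hki hkj hk
    -- Induction covers only the lower part of x_j N. Its leading term X_j N may have degree n, but
    -- k is a lower bound for it, so `key₁` applies.
    have h₁ : action b (b i) (action b (b k) (action b (b j) (monomial N 1))) =
        action b (b k) (action b (b i) (action b (b j) (monomial N 1))) +
          action b ⁅b i, b k⁆ (action b (b j) (monomial N 1)) := by
      rw [← sub_add_cancel (action b (b j) (monomial N 1)) (X j * monomial N 1)]
      simp only [map_add]
      rw [ih _ hN _ _ (action_sub_mem b j N), X_mul_monomial, key₁ hki (hk.add_single hkj.le)]
      abel
    rw [action_X_mul b hkj hk, map_add, h₁,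
      ih _ hN (b i) ⁅b j, b k⁆ (monomial_mem_degreeLE le_rfl)]
    abel
  have key₃ : ∀ {i j : σ} {M : σ →₀ ℕ}, j < i → M.degree ≤ n →
      action b (b i) (action b (b j) (monomial M 1)) =
        action b (b j) (action b (b i) (monomial M 1)) + action b ⁅b i, b j⁆ (monomial M 1) := by
    intro i j M hji hM
    by_cases h : LowerBound j M
    · exact key₁ hji h
    · obtain ⟨k, N, rfl, hkj, hk⟩ := exists_eq_add_single_of_not_lowerBound h
      have hN : N.degree < n := by
        have : N.degree + 1 ≤ n := by simpa using hM
        lia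
      have h₁ := ih _ hN ⁅b i, b j⁆ (b k) (monomial_mem_degreeLE (le_refl N.degree))
      have h₂ := ih _ hN (b i) (b j) (monomial_mem_degreeLE (le_refl N.degree))
      rw [action_of_lowerBound b hk] at h₁
      -- Compare `key₂` with its i, j-swapped form: the mixed terms agree, and the Jacobi identity
      -- accounts for the double brackets.
      rw [← X_mul_monomial, key₂ hN (hkj.trans hji) hkj hk, key₂ hN hkj (hkj.trans hji) hk, h₁, h₂,
        map_add, lie_lie, map_sub, LinearMap.sub_apply]
      abel
  induction hf using degreeLE_induction with
  | mono M hM =>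
    induction x using basis_induction b with
    | basis i =>
      induction y using basis_induction b with
      | basis j =>
        rcases lt_trichotomy i j with h | rfl | h
        · rw [key₃ h hM, add_assoc, ← LinearMap.add_apply, ← map_add, ← lie_skew (b i) (b j),
            add_neg_cancel, map_zero, LinearMap.zero_apply, add_zero]
        · simp
        · exact key₃ h hM
      | zero => simp
      | add x y hx hy => simp only [map_add, LinearMap.add_apply, hx, hy, lie_add]; abel
      | smul c x hx => simp only [map_smul, LinearMap.smul_apply, hx, lie_smul, smul_add]
    | zero => simp
    | add x y hx hy => simp only [map_add, LinearMap.add_apply, hx, hy, add_lie]; abel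
    | smul c x hx => simp only [map_smul, LinearMap.smul_apply, hx, smul_lie, smul_add]
  | zero => simp
  | add f g _ _ hf hg => simp only [map_add, hf, hg]; abel
  | smul c f _ hf => simp only [map_smul, hf, smul_add]

theorem action_lie (x y : L) (f : MvPolynomial σ K) :
    action b ⁅x, y⁆ f = action b x (action b y f) - action b y (action b x f) := by
  obtain ⟨n, hn⟩ := exists_mem_degreeLE f
  rw [action_lie_aux b n x y hn, add_sub_cancel_left]

end Action

section Enveloping

attribute [local instance] LieRing.ofAssociativeRing

variable [LinearOrder σ] (b : Basis σ K L)

/-- The representation of the enveloping algebra on polynomials. -/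
noncomputable def representation :
    UniversalEnvelopingAlgebra K L →ₐ[K] End K (MvPolynomial σ K) :=
  UniversalEnvelopingAlgebra.lift K
    { action b with
      map_lie' := fun {x y} => by
        refine LinearMap.ext fun f => ?_
        simp only [AddHom.toFun_eq_coe, LinearMap.coe_toAddHom, LieRing.of_associative_ring_bracket]
        exact action_lie b x y f }

theorem representation_ι (x : L) :
    representation b (UniversalEnvelopingAlgebra.ι K x) = action b x := by
  rw [representation, UniversalEnvelopingAlgebra.lift_ι_apply]
  rfl

/-- The linear map sending a monomial to the ordered product of its variables. -/
noncomputable def orderedProduct : MvPolynomial σ K →ₗ[K] UniversalEnvelopingAlgebra K L :=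
  (basisMonomials σ K).constr K fun M =>
    (((Finsupp.toMultiset M).sort (· ≤ ·)).map fun i => UniversalEnvelopingAlgebra.ι K (b i)).prod

theorem orderedProduct_monomial (M : σ →₀ ℕ) :
    orderedProduct b (monomial M 1) = (((Finsupp.toMultiset M).sort (· ≤ ·)).map fun i =>
      UniversalEnvelopingAlgebra.ι K (b i)).prod := by
  rw [orderedProduct, ← congrFun (coe_basisMonomials (σ := σ) (R := K)) M, Basis.constr_basis]

theorem orderedProduct_one : orderedProduct b 1 = 1 := by
  have := orderedProduct_monomial b 0
  simpa using this

theorem orderedProduct_X_mul {i : σ} {M : σ →₀ ℕ} (h : LowerBound i M) :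
    orderedProduct b (X i * monomial M 1) =
      UniversalEnvelopingAlgebra.ι K (b i) * orderedProduct b (monomial M 1) := by
  rw [X_mul_monomial, orderedProduct_monomial, orderedProduct_monomial, add_comm, map_add,
    Finsupp.toMultiset_single, one_smul, Multiset.singleton_add, Multiset.sort_cons, List.map_cons,
    List.prod_cons]
  intro j hj
  exact h j (by simpa using hj)

/-- The recursion defining the action is the reordering of products in U(L), so ordered products
intertwine the action with left multiplication. -/
theorem orderedProduct_action_aux (n : ℕ) (x : L) {f : MvPolynomial σ K}
    (hf : f ∈ degreeLE K σ n) :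
    orderedProduct b (action b x f) = UniversalEnvelopingAlgebra.ι K x * orderedProduct b f := by
  induction n using Nat.strong_induction_on generalizing x f with
  | _ n ih =>
  induction hf using degreeLE_induction with
  | mono M hM =>
    induction x using basis_induction b with
    | basis i =>
      by_cases h : LowerBound i M
      · rw [action_of_lowerBound b h, orderedProduct_X_mul b h]
      · obtain ⟨j, N, rfl, hji, hj⟩ := exists_eq_add_single_of_not_lowerBound h
        have hN : N.degree < n := by
          have : N.degree + 1 ≤ n := by simpa using hM
          lia
        have h₁ : orderedProduct b (action b (b j) (action b (b i) (monomial N 1))) =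
            UniversalEnvelopingAlgebra.ι K (b j) *
              orderedProduct b (action b (b i) (monomial N 1)) := by
          rw [← sub_add_cancel (action b (b i) (monomial N 1)) (X i * monomial N 1)]
          simp only [map_add, mul_add]
          rw [ih _ hN _ (action_sub_mem b i N), X_mul_monomial,
            action_of_lowerBound b (hj.add_single hji.le),
            orderedProduct_X_mul b (hj.add_single hji.le)]
        have h₂ := monomial_mem_degreeLE (K := K) (le_refl N.degree)
        rw [← X_mul_monomial, action_X_mul b hji hj, map_add, h₁, ih _ hN _ h₂, ih _ hN _ h₂,
          orderedProduct_X_mul b hj, LieHom.map_lie, LieRing.of_associative_ring_bracket]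
        noncomm_ring
    | zero => simp
    | add x y hx hy => simp only [map_add, LinearMap.add_apply, hx, hy, add_mul]
    | smul c x hx => simp only [map_smul, LinearMap.smul_apply, hx, smul_mul_assoc]
  | zero => simp
  | add f g _ _ hf hg => simp only [map_add, hf, hg, mul_add]
  | smul c f _ hf => simp only [map_smul, hf, mul_smul_comm]

theorem orderedProduct_action (x : L) (f : MvPolynomial σ K) :
    orderedProduct b (action b x f) = UniversalEnvelopingAlgebra.ι K x * orderedProduct b f :=
  (exists_mem_degreeLE f).elim fun n hn => orderedProduct_action_aux b n x hn

end Enveloping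

end PoincareBirkhoffWitt

/-! ### Regularity of y and of x - c modulo y in U(L). -/

namespace PoincareBirkhoffWitt

open MvPolynomial Module

variable {K : Type u} {L : Type v} {σ : Type w} [Field K] [LieRing L] [LieAlgebra K L]

section Regular

theorem polynomial_induction {p : MvPolynomial σ K → Prop}
    (mono : ∀ M : σ →₀ ℕ, p (monomial M 1)) (zero : p 0)
    (add : ∀ f g, p f → p g → p (f + g)) (smul : ∀ (c : K) f, p f → p (c • f))
    (f : MvPolynomial σ K) : p f := by
  obtain ⟨n, hn⟩ := exists_mem_degreeLE f
  induction hn using degreeLE_induction with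
  | mono M hM => exact mono M
  | zero => exact zero
  | add f g _ _ hf hg => exact add f g hf hg
  | smul c f _ hf => exact smul c f hf

variable [LinearOrder σ] (b : Basis σ K L)

theorem action_bot {i : σ} (hi : ∀ k, i ≤ k) (f : MvPolynomial σ K) :
    action b (b i) f = X i * f := by
  induction f using polynomial_induction with
  | mono M => exact action_of_lowerBound b fun k _ => hi k
  | zero => simp
  | add f g hf hg => rw [map_add, hf, hg, mul_add]
  | smul c f hf => rw [map_smul, hf, mul_smul_comm]

/-- If j is not a lower bound of M, then M contains the variable i. Since the bracket is a multiple
of b i, which acts as X_i, both terms are then divisible by X_i. -/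
theorem X_dvd_action_sub {i j : σ} (hi : ∀ k, i ≤ k) (hj : ∀ k, k ≠ i → j ≤ k) (hij : i < j)
    {a : K} (ha : ⁅b j, b i⁆ = a • b i) (f : MvPolynomial σ K) :
    X i ∣ action b (b j) f - X j * f := by
  induction f using polynomial_induction with
  | mono M =>
    by_cases h : LowerBound j M
    · rw [action_of_lowerBound b h, sub_self]
      exact dvd_zero _
    · obtain ⟨k, N, rfl, hkj, hk⟩ := exists_eq_add_single_of_not_lowerBound h
      obtain rfl : k = i := by_contra fun hne => absurd (hj k hne) (not_le.2 hkj)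
      rw [← X_mul_monomial, action_X_mul b hkj hk, action_bot b hi, ha, map_smul,
        LinearMap.smul_apply, action_bot b hi, mul_left_comm, ← mul_smul_comm]
      exact dvd_sub (dvd_add (dvd_mul_right _ _) (dvd_mul_right _ _)) (dvd_mul_right _ _)
  | zero => simp
  | add f g hf hg =>
    rw [map_add, mul_add, add_sub_add_comm]
    exact dvd_add hf hg
  | smul c f hf =>
    rw [map_smul, mul_smul_comm, ← smul_sub]
    exact dvd_smul_of_dvd c hf

theorem X_dvd_of_X_dvd_X_sub_C_mul {i j : σ} (hij : i ≠ j) (a : K) {f : MvPolynomial σ K}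
    (h : X i ∣ (X j - C a) * f) : X i ∣ f := by
  refine ((MvPolynomial.X_prime (i := i)).dvd_or_dvd h).resolve_left fun h => ?_
  obtain ⟨g, hg⟩ := h
  classical
  -- At this point X_j - a takes the value 1 while X_i vanishes.
  have := congrArg (MvPolynomial.eval fun k => if k = i then 0 else a + 1) hg
  simp [hij.symm] at this

/-- Any two elements can be made the first two elements of a linear order. -/
theorem exists_linearOrder {ι : Type w} {i j : ι} (hij : i ≠ j) :
    ∃ _ : LinearOrder ι, (∀ k, i ≤ k) ∧ (∀ k, k ≠ i → j ≤ k) ∧ i < j := by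
  classical
  let := linearOrderOfSTO (WellOrderingRel (α := ι))
  -- The two added bottoms receive i and j; the order is pulled back along this injection.
  let f : ι → WithBot (WithBot ι) := fun k =>
    if k = i then ⊥ else if k = j then ((⊥ : WithBot ι) : WithBot (WithBot ι)) else
      ((k : WithBot ι) : WithBot (WithBot ι))
  have hi : f i = ⊥ := if_pos rfl
  have hj : f j = ((⊥ : WithBot ι) : WithBot (WithBot ι)) := by simp [f, hij.symm]
  have hf : Function.Injective f := by
    intro k l h
    simp only [f] at h
    split_ifs at h <;> simp_all
  refine ⟨LinearOrder.lift' f hf, fun k => ?_, fun k hk => ?_, ?_⟩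
  · change f i ≤ f k
    rw [hi]
    exact bot_le
  · change f j ≤ f k
    have h : f k = if k = j then ((⊥ : WithBot ι) : WithBot (WithBot ι)) else
      ((k : WithBot ι) : WithBot (WithBot ι)) := if_neg hk
    rw [hj, h]
    split_ifs
    · exact le_rfl
    · exact WithBot.coe_le_coe.2 bot_le
  · change f i < f j
    rw [hi, hj]
    exact WithBot.bot_lt_coe _

/-- Linearly independent elements `y`, `x` can be completed to an ordered basis in which they are
the first two elements. -/
theorem exists_basis_of_linearIndependent {y x : L} (h : LinearIndependent K ![y, x]) :
    ∃ (σ : Type v) (_ : LinearOrder σ) (b : Basis σ K L) (i j : σ), b i = y ∧ b j = x ∧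
      (∀ k, i ≤ k) ∧ (∀ k, k ≠ i → j ≤ k) ∧ i < j := by
  have hs := h.linearIndepOn_id
  let b := Basis.extend hs
  let i : hs.extend (Set.subset_univ _) := ⟨y, hs.subset_extend _ ⟨0, rfl⟩⟩
  let j : hs.extend (Set.subset_univ _) := ⟨x, hs.subset_extend _ ⟨1, rfl⟩⟩
  have hij : i ≠ j := fun e => absurd (h.injective (a₁ := 0) (a₂ := 1) (congrArg Subtype.val e))
    (by simp)
  obtain ⟨_, h₁, h₂, h₃⟩ := exists_linearOrder hij
  exact ⟨_, _, b, i, j, Basis.extend_apply_self hs i, Basis.extend_apply_self hs j, h₁, h₂, h₃⟩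

end Regular

section Enveloping

attribute [local instance] LieRing.ofAssociativeRing

variable [LinearOrder σ] (b : Basis σ K L)

theorem representation_ι_mul (x : L) (u : UniversalEnvelopingAlgebra K L) (f : MvPolynomial σ K) :
    representation b (UniversalEnvelopingAlgebra.ι K x * u) f =
      action b x (representation b u f) := by
  rw [map_mul, representation_ι, Module.End.mul_apply]

/-- The universal property maps U(L) into the subalgebra where p holds; by uniqueness, following
this with the inclusion gives the identity. -/
theorem enveloping_induction {p : UniversalEnvelopingAlgebra K L → Prop}
    (ι : ∀ x, p (UniversalEnvelopingAlgebra.ι K x)) (algebraMap : ∀ c, p (algebraMap K _ c))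
    (add : ∀ u v, p u → p v → p (u + v)) (mul : ∀ u v, p u → p v → p (u * v))
    (u : UniversalEnvelopingAlgebra K L) : p u := by
  let S : Subalgebra K (UniversalEnvelopingAlgebra K L) :=
    { carrier := {u | p u}
      mul_mem' := fun {u v} => mul u v
      add_mem' := fun {u v} => add u v
      algebraMap_mem' := algebraMap }
  let f : UniversalEnvelopingAlgebra K L →ₐ[K] S := UniversalEnvelopingAlgebra.lift K
    { toFun := fun x => ⟨UniversalEnvelopingAlgebra.ι K x, ι x⟩
      map_add' := fun x y => Subtype.ext (map_add _ _ _)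
      map_smul' := fun x y => Subtype.ext (map_smul _ _ _)
      map_lie' := fun {x y} => Subtype.ext (LieHom.map_lie _ _ _) }
  have h : S.val.comp f = AlgHom.id K _ := by
    refine UniversalEnvelopingAlgebra.hom_ext K (LieHom.ext fun x => ?_)
    change (f (UniversalEnvelopingAlgebra.ι K x) : UniversalEnvelopingAlgebra K L) =
      UniversalEnvelopingAlgebra.ι K x
    rw [UniversalEnvelopingAlgebra.lift_ι_apply]
    rfl
  have h' := congrArg (fun g => g u) h
  rw [← show ((f u : S) : UniversalEnvelopingAlgebra K L) = u from h']
  exact (f u).2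

theorem orderedProduct_representation (u : UniversalEnvelopingAlgebra K L)
    (f : MvPolynomial σ K) :
    orderedProduct b (representation b u f) = u * orderedProduct b f := by
  induction u using enveloping_induction generalizing f with
  | ι x => rw [representation_ι, orderedProduct_action]
  | algebraMap c =>
    rw [AlgHom.commutes, Module.algebraMap_end_apply, map_smul, Algebra.smul_def]
  | add u v hu hv => rw [map_add, LinearMap.add_apply, map_add, hu, hv, add_mul]
  | mul u v hu hv => rw [map_mul, Module.End.mul_apply, hu, hv, mul_assoc]

/-- This is the injectivity in Poincaré–Birkhoff–Witt: equations in U(L) can be tested on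
polynomials. -/
theorem orderedProduct_representation_one (u : UniversalEnvelopingAlgebra K L) :
    orderedProduct b (representation b u 1) = u := by
  rw [orderedProduct_representation, orderedProduct_one, mul_one]

open UniversalEnvelopingAlgebra in
theorem eq_zero_of_ι_mul_eq_zero {y x : L} (h : LinearIndependent K ![y, x])
    {u : UniversalEnvelopingAlgebra K L} (hu : ι K y * u = 0) : u = 0 := by
  obtain ⟨σ, _, b, i, j, rfl, rfl, hi, hj, hij⟩ := exists_basis_of_linearIndependent h
  have h₁ : X i * representation b u 1 = 0 := by
    rw [← action_bot b hi, ← representation_ι_mul, hu, map_zero, LinearMap.zero_apply]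
  rw [← orderedProduct_representation_one b u, (mul_eq_zero.1 h₁).resolve_left (X_ne_zero i),
    map_zero]

-- Under u ↦ u·1 the claim becomes primality of X_i together with X_i ∤ X_j - c. The shift c = a
-- serves the lower bound, c = 0 the upper one.
open UniversalEnvelopingAlgebra in
theorem exists_eq_ι_mul {y x : L} (h : LinearIndependent K ![y, x]) {a : K}
    (hxy : ⁅x, y⁆ = a • y) (c : K) {p q : UniversalEnvelopingAlgebra K L}
    (hpq : ι K x * q = c • q + ι K y * p) : ∃ r, q = ι K y * r := by
  obtain ⟨σ, _, b, i, j, rfl, rfl, hi, hj, hij⟩ := exists_basis_of_linearIndependent h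
  have h₁ : action b (b j) (representation b q 1) =
      c • representation b q 1 + X i * representation b p 1 := by
    rw [← action_bot b hi, ← representation_ι_mul, ← representation_ι_mul, hpq, map_add, map_smul,
      LinearMap.add_apply, LinearMap.smul_apply]
  have h₂ : X i ∣ (X j - C c) * representation b q 1 := by
    have h₃ := X_dvd_action_sub b hi hj hij hxy (representation b q 1)
    have h₄ : (X j - C c) * representation b q 1 = X i * representation b p 1 -
        (action b (b j) (representation b q 1) - X j * representation b q 1) := by
      rw [h₁, smul_eq_C_mul]
      ring
    rw [h₄]
    exact dvd_sub (dvd_mul_right _ _) h₃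
  obtain ⟨r, hr⟩ := X_dvd_of_X_dvd_X_sub_C_mul hij.ne c h₂
  refine ⟨orderedProduct b r, ?_⟩
  rw [← orderedProduct_action, action_bot b hi, ← hr, orderedProduct_representation_one]

end Enveloping

end PoincareBirkhoffWitt

/-! ### Trivial modules over augmented rings: criteria for dimension at least and at most two. -/

namespace LieCohomologicalDimension

open CategoryTheory Module

section ScalarModule

variable {K : Type u} [Field K]

/-- The field `K` as a module over a ring `R` which acts through a homomorphism `R → K`. -/
noncomputable def scalarModule {R : Type w} [Ring R] (ε : R →+* K) : ModuleCat.{max u v} R :=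
  letI : Module R (ULift.{v} K) := Module.compHom (ULift.{v} K) ε
  ModuleCat.of R (ULift.{v} K)

/-- Used to pass from right to left modules, and from U(L) to polynomial rings. -/
theorem projectiveDimension_scalarModule_eq {R : Type w} {R' : Type w'} [Ring R] [Ring R']
    [Small.{max u v} R] [Small.{max u v} R'] (e : R ≃+* R') (ε : R →+* K) (ε' : R' →+* K)
    (h : ∀ r, ε' (e r) = ε r) :
    projectiveDimension (scalarModule.{u, v} ε) = projectiveDimension (scalarModule.{u, v} ε') := by
  let := RingHomInvPair.of_ringEquiv e
  let := RingHomInvPair.of_ringEquiv e.symm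
  let e' : scalarModule.{u, v} ε ≃ₛₗ[RingHomClass.toRingHom e] scalarModule.{u, v} ε' :=
    { AddEquiv.refl (ULift.{v} K) with
      map_smul' := fun r m => ULift.ext _ _ (by
        change ε r * m.down = ε' (e r) * m.down
        rw [h]) }
  exact ModuleCat.projectiveDimension_eq_of_semiLinearEquiv e e'

/-- The augmentation as a linear map. -/
noncomputable def toScalarModule {R : Type w} [Ring R] (ε : R →+* K) :
    R →ₗ[R] scalarModule.{u, v} ε where
  toFun r := (ULift.up (ε r) : ULift.{v} K)
  map_add' r s := ULift.ext _ _ (map_add ε r s)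
  map_smul' r s := ULift.ext _ _ (map_mul ε r s)

theorem toScalarModule_eq_zero_iff {R : Type w} [Ring R] (ε : R →+* K) (r : R) :
    toScalarModule.{u, v} ε r = 0 ↔ ε r = 0 :=
  ⟨fun h => congrArg ULift.down h, fun h => ULift.ext _ _ h⟩

theorem shortExact_toScalarModule {R : Type (max u v)} [Ring R] {ε : R →+* K}
    (hε : Function.Surjective ε) : (toScalarModule.{u, v} ε).shortComplexKer.ShortExact :=
  LinearMap.shortExact_shortComplexKer fun m => by
    obtain ⟨r, hr⟩ := hε (ULift.down m)
    exact ⟨r, ULift.ext _ _ hr⟩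

theorem projective_ker_toScalarModule {R : Type (max u v)} [Ring R] {ε : R →+* K}
    (hε : Function.Surjective ε) (h : HasProjectiveDimensionLT (scalarModule.{u, v} ε) 2) :
    Module.Projective R (LinearMap.ker (toScalarModule.{u, v} ε)) := by
  have h₁ := ((shortExact_toScalarModule hε).hasProjectiveDimensionLT_X₃_iff 0
    (ModuleCat.projective_of_free (Basis.singleton Unit R))).1 h
  rw [zero_add, ← projective_iff_hasProjectiveDimensionLT_one] at h₁
  exact (IsProjective.iff_projective _).2 h₁

/-- If `x`, `y` lie in a projective augmentation ideal and satisfy `x y = a y + y x`, then `y` and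
`x - a` is not a regular sequence. -/
theorem not_projective_ker {R : Type w} [Ring R] [Algebra K R] (ε : R →+* K) {x y : R} {a : K}
    (hx : ε x = 0) (hy : ε y = 0) (hxy : x * y = a • y + y * x)
    (h₁ : ∀ u, y * u = 0 → u = 0) (h₂ : ∀ p q, x * q = a • q + y * p → ∃ r, q = y * r) :
    ¬ Module.Projective R (LinearMap.ker (toScalarModule.{u, v} ε)) := by
  rintro ⟨s, hs⟩
  let x' : LinearMap.ker (toScalarModule.{u, v} ε) := ⟨x, (toScalarModule_eq_zero_iff ε x).2 hx⟩
  let y' : LinearMap.ker (toScalarModule.{u, v} ε) := ⟨y, (toScalarModule_eq_zero_iff ε y).2 hy⟩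
  have h₃ : x • y' = algebraMap K R a • y' + y • x' := Subtype.ext (by
    change x * y = algebraMap K R a * y + y * x
    rw [hxy, Algebra.smul_def])
  -- The b-coordinate of s applied to `h₃` reads x s(y) = a s(y) + y s(x).
  have h₄ : ∀ b, ∃ r, s y' b = y * r := fun b => by
    refine h₂ (s x' b) _ ?_
    have := congrArg (fun z => s z b) h₃
    simpa [Algebra.smul_def] using this
  choose r hr using h₄
  -- Left cancellation of y keeps the support of the quotients finite.
  let ρ : LinearMap.ker (toScalarModule.{u, v} ε) →₀ R :=
    Finsupp.onFinset (s y').support r fun b hb => Finsupp.mem_support_iff.2 fun h =>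
      hb (h₁ _ ((hr b).symm.trans h))
  have h₅ : s y' = y • ρ := Finsupp.ext hr
  have h₆ := hs y'
  rw [h₅, map_smul] at h₆
  set m := Finsupp.linearCombination R id ρ
  -- The splitting gives y = y m with m in the augmentation ideal; cancelling y puts 1 there.
  have h₇ : y * (m.1 - 1) = 0 := by
    rw [mul_sub, mul_one, sub_eq_zero]
    exact congrArg Subtype.val h₆
  have h₈ : ε m.1 = 0 := (toScalarModule_eq_zero_iff ε _).1 m.2
  rw [sub_eq_zero.1 (h₁ _ h₇), map_one] at h₈
  exact one_ne_zero h₈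

/-- If the augmentation ideal is generated by `x` and `y`, and the only relation between them is
`y x = (x - a) y`, then the projective dimension of the trivial module is at most two. -/
theorem hasProjectiveDimensionLT_three {R : Type (max u v)} [Ring R] [Algebra K R] {ε : R →+* K}
    (hε : Function.Surjective ε) {x y : R} {a : K}
    (hx : ε x = 0) (hy : ε y = 0) (hxy : x * y = a • y + y * x)
    (h₁ : ∀ u, u * y = 0 → u = 0) (h₂ : ∀ p q, p * x = q * y → ∃ r, p = r * y)
    (h₃ : ∀ u, ε u = 0 → ∃ p q, u = p * x + q * y) :
    HasProjectiveDimensionLT (scalarModule.{u, v} ε) 3 := by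
  refine ((shortExact_toScalarModule hε).hasProjectiveDimensionLT_X₃_iff 1
    (ModuleCat.projective_of_free (Basis.singleton Unit R))).2 ?_
  let x' : LinearMap.ker (toScalarModule.{u, v} ε) := ⟨x, (toScalarModule_eq_zero_iff ε x).2 hx⟩
  let y' : LinearMap.ker (toScalarModule.{u, v} ε) := ⟨y, (toScalarModule_eq_zero_iff ε y).2 hy⟩
  let f : (R × R) →ₗ[R] LinearMap.ker (toScalarModule.{u, v} ε) :=
    (LinearMap.toSpanSingleton R _ x').coprod (LinearMap.toSpanSingleton R _ y')
  have hf : ∀ p, (f p).1 = p.1 * x + p.2 * y := fun p => rfl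
  have hsurj : Function.Surjective f := fun u => by
    obtain ⟨p, q, h⟩ := h₃ u.1 ((toScalarModule_eq_zero_iff ε _).1 u.2)
    exact ⟨(p, q), Subtype.ext h.symm⟩
  -- The syzygy (y, a - x) encodes y x = (x - a) y.
  let g : R →ₗ[R] LinearMap.ker f :=
    ((LinearMap.toSpanSingleton R R y).prod
      (LinearMap.toSpanSingleton R R (algebraMap K R a - x))).codRestrict _ fun u => by
        refine LinearMap.mem_ker.2 (Subtype.ext ?_)
        rw [hf]
        change u * y * x + u * (algebraMap K R a - x) * y = 0
        rw [mul_assoc, mul_assoc, ← mul_add, sub_mul, hxy, Algebra.smul_def]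
        simp
  have hg : ∀ u, (g u).1 = (u * y, u * (algebraMap K R a - x)) := fun u => rfl
  have hbij : Function.Bijective g := by
    refine ⟨(injective_iff_map_eq_zero g).2 fun u hu => h₁ u ?_, fun ⟨⟨p, q⟩, hpq⟩ => ?_⟩
    · exact congrArg (fun z => z.1.1) hu
    · have h₄ : p * x + q * y = 0 := congrArg Subtype.val (LinearMap.mem_ker.1 hpq)
      obtain ⟨r, rfl⟩ := h₂ p (-q) (by rw [neg_mul, ← add_eq_zero_iff_eq_neg, h₄])
      refine ⟨r, Subtype.ext (Prod.ext rfl ?_)⟩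
      refine (sub_eq_zero.1 (h₁ _ ?_)).symm
      change (q - r * (algebraMap K R a - x)) * y = 0
      have h₅ : y * x = (x - algebraMap K R a) * y := by
        rw [sub_mul, hxy, Algebra.smul_def, add_sub_cancel_left]
      rw [mul_assoc, h₅] at h₄
      rw [← h₄]
      noncomm_ring
  have hker : Module.Projective R (LinearMap.ker f) :=
    Module.Projective.of_equiv (LinearEquiv.ofBijective g hbij)
  have hker' : HasProjectiveDimensionLT f.shortComplexKer.X₁ 1 :=
    projective_iff_hasProjectiveDimensionLT_one.1
      ((IsProjective.iff_projective _).1 hker)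
  refine (LinearMap.shortExact_shortComplexKer hsurj).hasProjectiveDimensionLT_X₃ 1 hker' ?_
  have : Projective f.shortComplexKer.X₂ :=
    (IsProjective.iff_projective (R × R)).1 inferInstance
  infer_instance

end ScalarModule

end LieCohomologicalDimension

/-! ### Enveloping algebras: left-right symmetry and the bounds by two. -/

namespace LieCohomologicalDimension

open Module MulOpposite PoincareBirkhoffWitt

open CategoryTheory (projectiveDimension projectiveDimension_ge_iff projectiveDimension_le_iff)

section Enveloping

attribute [local instance] LieRing.ofAssociativeRing

open UniversalEnvelopingAlgebra

variable (K : Type u) (L : Type v) [Field K] [LieRing L] [LieAlgebra K L]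

/-- The principal anti-automorphism of the enveloping algebra. -/
noncomputable def antipode : UniversalEnvelopingAlgebra K L →ₐ[K]
    (UniversalEnvelopingAlgebra K L)ᵐᵒᵖ :=
  lift K
    { toFun := fun x => -op (ι K x)
      map_add' := fun x y => by rw [map_add, op_add, neg_add]
      map_smul' := fun c x => by rw [map_smul, op_smul, smul_neg, RingHom.id_apply]
      map_lie' := fun {x y} => by
        simp only [LieHom.map_lie, LieRing.of_associative_ring_bracket, op_sub, op_mul, neg_mul_neg,
          neg_sub] }

theorem antipode_ι (x : L) : antipode K L (ι K x) = -op (ι K x) :=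
  lift_ι_apply K _ x

theorem unop_antipode_unop_antipode (u : UniversalEnvelopingAlgebra K L) :
    (antipode K L (antipode K L u).unop).unop = u := by
  induction u using enveloping_induction with
  | ι x => simp only [antipode_ι, unop_neg, unop_op, map_neg, neg_neg]
  | algebraMap c => simp only [AlgHom.commutes, MulOpposite.algebraMap_apply, unop_op]
  | add u v hu hv => simp only [map_add, unop_add, hu, hv]
  | mul u v hu hv => simp only [map_mul, unop_mul, hu, hv]

/-- The principal anti-automorphism as an equivalence. -/
noncomputable def antipodeEquiv : UniversalEnvelopingAlgebra K L ≃+*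
    (UniversalEnvelopingAlgebra K L)ᵐᵒᵖ :=
  { (antipode K L).toRingHom with
    invFun := fun u => (antipode K L u.unop).unop
    left_inv := unop_antipode_unop_antipode K L
    right_inv := fun u => unop_injective (unop_antipode_unop_antipode K L u.unop) }

theorem augmentation_antipode (u : UniversalEnvelopingAlgebra K L) :
    augmentation K L (antipode K L u).unop = augmentation K L u := by
  induction u using enveloping_induction with
  | ι x => rw [antipode_ι, unop_neg, unop_op, map_neg, augmentation_ι, neg_zero]
  | algebraMap c => rw [AlgHom.commutes, MulOpposite.algebraMap_apply, unop_op]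
  | add u v hu hv => simp only [map_add, unop_add, hu, hv]
  | mul u v hu hv => rw [map_mul, unop_mul, map_mul, hu, hv, map_mul, mul_comm]

theorem cd_eq_projectiveDimension : cd K L =
    projectiveDimension (scalarModule.{u, v} (augmentation K L).toRingHom) :=
  (projectiveDimension_scalarModule_eq (antipodeEquiv K L) _
    ((augmentation K L).toRingHom.fromOpposite fun _ _ => mul_comm _ _)
    (augmentation_antipode K L)).symm

theorem augmentation_surjective : Function.Surjective (augmentation K L) := fun c =>
  ⟨algebraMap K _ c, AlgHom.commutes _ c⟩

variable {K L}

theorem ι_mul_ι {x y : L} {a : K} (hxy : ⁅x, y⁆ = a • y) :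
    ι K x * ι K y = a • ι K y + ι K y * ι K x := by
  rw [← map_smul, ← hxy, LieHom.map_lie, LieRing.of_associative_ring_bracket, sub_add_cancel]

/-- The pair lives in an arbitrary L, so subalgebras are handled without comparing enveloping
algebras. -/
theorem two_le_cd {y x : L} (h : LinearIndependent K ![y, x]) {a : K} (hxy : ⁅x, y⁆ = a • y) :
    2 ≤ cd K L := by
  rw [cd_eq_projectiveDimension]
  refine (projectiveDimension_ge_iff _ 2).2 fun hpd => ?_
  exact not_projective_ker (augmentation K L).toRingHom (augmentation_ι K L x)
    (augmentation_ι K L y) (ι_mul_ι hxy) (fun _ => eq_zero_of_ι_mul_eq_zero h)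
    (fun _ _ => exists_eq_ι_mul h hxy a)
    (projective_ker_toScalarModule (augmentation_surjective K L) hpd)

theorem eq_zero_of_mul_ι_eq_zero {y x : L} (h : LinearIndependent K ![y, x])
    {u : UniversalEnvelopingAlgebra K L} (hu : u * ι K y = 0) : u = 0 := by
  have h₁ := congrArg (fun w => (antipode K L w).unop) hu
  simp only [map_mul, unop_mul, antipode_ι, unop_neg, unop_op, neg_mul, map_zero, unop_zero,
    neg_eq_zero] at h₁
  rw [← unop_antipode_unop_antipode K L u, eq_zero_of_ι_mul_eq_zero h h₁, map_zero, unop_zero]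

/-- The antipode turns p x = q y into an equation x p' = y q', the unshifted case of
`exists_eq_ι_mul`. -/
theorem exists_eq_mul_ι {y x : L} (h : LinearIndependent K ![y, x]) {a : K}
    (hxy : ⁅x, y⁆ = a • y) {p q : UniversalEnvelopingAlgebra K L}
    (hpq : p * ι K x = q * ι K y) : ∃ r, p = r * ι K y := by
  have h₁ := congrArg (fun w => (antipode K L w).unop) hpq
  simp only [map_mul, unop_mul, antipode_ι, unop_neg, unop_op, neg_mul, neg_inj] at h₁
  obtain ⟨r, hr⟩ := exists_eq_ι_mul h hxy (0 : K) (h₁.trans (by rw [zero_smul, zero_add]))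
  refine ⟨-(antipode K L r).unop, ?_⟩
  rw [← unop_antipode_unop_antipode K L p, hr, map_mul, unop_mul, antipode_ι, unop_neg, unop_op,
    mul_neg, neg_mul]

theorem exists_eq_mul_add_mul {y x : L} (h : ⊤ ≤ Submodule.span K (Set.range ![y, x]))
    (u : UniversalEnvelopingAlgebra K L) :
    ∃ p q, u = algebraMap K _ (augmentation K L u) + (p * ι K x + q * ι K y) := by
  induction u using enveloping_induction with
  | ι z =>
    have hz : z ∈ Submodule.span K (Set.range ![y, x]) := h trivial
    simp only [Matrix.range_cons, Matrix.range_empty, Set.union_empty, Set.singleton_union,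
      Submodule.mem_span_pair] at hz
    obtain ⟨c, d, rfl⟩ := hz
    refine ⟨algebraMap K _ d, algebraMap K _ c, ?_⟩
    rw [augmentation_ι, map_zero, zero_add, map_add, map_smul, map_smul, Algebra.smul_def,
      Algebra.smul_def, add_comm]
  | algebraMap c => exact ⟨0, 0, by simp⟩
  | add u v hu hv =>
    obtain ⟨p, q, hu⟩ := hu
    obtain ⟨p', q', hv⟩ := hv
    refine ⟨p + p', q + q', ?_⟩
    conv_lhs => rw [hu, hv]
    rw [map_add, map_add]
    noncomm_ring
  | mul u v hu hv =>
    obtain ⟨p, q, hu⟩ := hu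
    obtain ⟨p', q', hv⟩ := hv
    refine ⟨algebraMap K _ (augmentation K L v) * p + u * p',
      algebraMap K _ (augmentation K L v) * q + u * q', ?_⟩
    -- Split v as ε(v) plus its part in the augmentation ideal, so that x and y stay on the right.
    have h₁ : u * v = algebraMap K _ (augmentation K L v) * u + u * (p' * ι K x + q' * ι K y) := by
      rw [Algebra.commutes, ← mul_add, ← hv]
    have h₂ : algebraMap K _ (augmentation K L (u * v)) =
        algebraMap K (UniversalEnvelopingAlgebra K L) (augmentation K L v) *
          algebraMap K _ (augmentation K L u) := by
      rw [← map_mul, map_mul, mul_comm]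
    have h₃ : algebraMap K _ (augmentation K L v) * u =
        algebraMap K _ (augmentation K L v) * algebraMap K _ (augmentation K L u) +
          algebraMap K _ (augmentation K L v) * (p * ι K x + q * ι K y) := by
      rw [← mul_add, ← hu]
    rw [h₂, h₁, h₃]
    noncomm_ring

theorem cd_le_two {y x : L} (h : LinearIndependent K ![y, x])
    (hspan : ⊤ ≤ Submodule.span K (Set.range ![y, x])) {a : K} (hxy : ⁅x, y⁆ = a • y) :
    cd K L ≤ 2 := by
  rw [cd_eq_projectiveDimension]
  refine (projectiveDimension_le_iff _ 2).2 ?_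
  refine hasProjectiveDimensionLT_three (augmentation_surjective K L) (augmentation_ι K L x)
    (augmentation_ι K L y) (ι_mul_ι hxy) (fun _ => eq_zero_of_mul_ι_eq_zero h)
    (fun _ _ => exists_eq_mul_ι h hxy) fun u hu => ?_
  obtain ⟨p, q, hpq⟩ := exists_eq_mul_add_mul hspan u
  refine ⟨p, q, hpq.trans ?_⟩
  rw [show augmentation K L u = 0 from hu, map_zero, zero_add]

end Enveloping

/-! ### Two-dimensional Lie algebras. -/

section TwoDimensional

variable {K : Type u} {L : Type v} [Field K] [LieRing L] [LieAlgebra K L]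

/-- A two-dimensional Lie algebra has a basis `y`, `x` with `[x, y]` a multiple of `y`. -/
theorem exists_lie_eq_smul (h : finrank K L = 2) :
    ∃ (y x : L) (a : K), LinearIndependent K ![y, x] ∧ ⁅x, y⁆ = a • y := by
  have : FiniteDimensional K L := FiniteDimensional.of_finrank_pos (by lia)
  let b := (finBasis K L).reindex (finCongr h)
  by_cases hz : ⁅b 0, b 1⁆ = 0
  · refine ⟨b 0, b 1, 0, ?_, ?_⟩
    · convert b.linearIndependent using 1
      ext i
      fin_cases i <;> rfl
    · rw [← lie_skew, hz, neg_zero, zero_smul]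
  -- The bracket y = c b₀ + d b₁ spans the derived algebra; x is a basis vector independent of y,
  -- namely b₀ if c = 0 and b₁ otherwise.
  · have hrepr := b.sum_repr ⁅b 0, b 1⁆
    rw [Fin.sum_univ_two] at hrepr
    set c := b.repr ⁅b 0, b 1⁆ 0
    set d := b.repr ⁅b 0, b 1⁆ 1
    have hb : LinearIndependent K ![b 0, b 1] := by
      convert b.linearIndependent using 1
      ext i
      fin_cases i <;> rfl
    have hb' := LinearIndependent.pair_iff.1 hb
    by_cases hc : c = 0
    · refine ⟨⁅b 0, b 1⁆, b 0, d, LinearIndependent.pair_iff.2 fun s t hst => ?_, ?_⟩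
      · have hd : d ≠ 0 := fun hd => hz (by rw [← hrepr, hc, hd, zero_smul, zero_smul, add_zero])
        rw [← hrepr, hc, zero_smul, zero_add, smul_smul, add_comm] at hst
        obtain ⟨h₁, h₂⟩ := hb' _ _ hst
        exact ⟨(mul_eq_zero.1 h₂).resolve_right hd, h₁⟩
      · nth_rw 1 [← hrepr]
        rw [hc, zero_smul, zero_add, lie_smul]
    · refine ⟨⁅b 0, b 1⁆, b 1, -c, LinearIndependent.pair_iff.2 fun s t hst => ?_, ?_⟩
      · rw [← hrepr, smul_add, smul_smul, smul_smul, add_assoc, ← add_smul] at hst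
        obtain ⟨h₁, h₂⟩ := hb' _ _ hst
        have hs := (mul_eq_zero.1 h₁).resolve_right hc
        exact ⟨hs, by rwa [hs, zero_mul, zero_add] at h₂⟩
      · nth_rw 1 [← hrepr]
        rw [lie_add, lie_smul, lie_smul, lie_self, smul_zero, add_zero, ← lie_skew, smul_neg,
          neg_smul]

theorem cd_eq_two_of_finrank_eq_two (h : finrank K L = 2) : cd K L = 2 := by
  obtain ⟨y, x, a, hli, hxy⟩ := exists_lie_eq_smul h
  refine le_antisymm (cd_le_two hli ?_ hxy) (two_le_cd hli hxy)
  exact (hli.span_eq_top_of_card_eq_finrank (by rw [h, Fintype.card_fin])).ge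

theorem two_le_cd_of_lieSubalgebra (S : LieSubalgebra K L) (h : finrank K S = 2) :
    2 ≤ cd K L := by
  obtain ⟨y, x, a, hli, hxy⟩ := exists_lie_eq_smul h
  refine two_le_cd (y := (y : L)) (x := (x : L)) (a := a) ?_ (congrArg Subtype.val hxy)
  rw [LinearIndependent.pair_iff] at hli ⊢
  exact fun s t hst => hli s t (Subtype.ext hst)

end TwoDimensional

end LieCohomologicalDimension

/-! ### Regular sequences and projective dimension over commutative rings. -/

namespace LieCohomologicalDimension

section RegularSequence

open CategoryTheory Abelian Module RingTheory.Sequence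

variable {R : Type u} [CommRing R]

/-- Each regular r gives 0 → M → M → M/rM → 0, which raises the dimension by at most one. -/
theorem hasProjectiveDimensionLT_quotient (M : ModuleCat.{w} R) (rs : List R)
    (reg : IsWeaklyRegular M rs) (k : ℕ) (hM : HasProjectiveDimensionLT M (k + 1)) :
    HasProjectiveDimensionLT (ModuleCat.of R (M ⧸ Ideal.ofList rs • (⊤ : Submodule R M)))
      (k + 1 + rs.length) := by
  induction rs generalizing M k with
  | nil =>
    have e : (M ⧸ Ideal.ofList ([] : List R) • (⊤ : Submodule R M)) ≃ₗ[R] M :=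
      Submodule.quotEquivOfEqBot _ (by rw [Ideal.ofList_nil, Submodule.bot_smul])
    exact hasProjectiveDimensionLT_of_iso e.symm.toModuleIso _
  | cons r rs ih =>
    rw [isWeaklyRegular_cons_iff] at reg
    have h₁ : HasProjectiveDimensionLT (ModuleCat.of R (QuotSMulTop r M)) (k + 1 + 1) :=
      (reg.1.smulShortComplex_shortExact (M := M)).hasProjectiveDimensionLT_X₃ (k + 1) hM
        (@hasProjectiveDimensionLT_of_ge _ _ _ M (k + 1) _ (Nat.le_succ _) hM)
    have h₂ := ih (ModuleCat.of R (QuotSMulTop r M)) reg.2 (k + 1) h₁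
    rw [List.length_cons, ← Nat.add_assoc, Nat.add_right_comm]
    exact hasProjectiveDimensionLT_of_iso
      (Submodule.quotOfListConsSMulTopEquivQuotSMulTopInner M r rs).symm.toModuleIso _

variable [Small.{w} R]

theorem nontrivial_ext_of_iso {M M' : ModuleCat.{w} R} (e : M ≅ M') (N : ModuleCat.{w} R) (k : ℕ)
    (h : Nontrivial (Ext M N k)) : Nontrivial (Ext M' N k) := by
  have hf : Function.Injective fun x : Ext M N k => (Ext.mk₀ e.inv).comp x (zero_add k) := by
    refine Function.LeftInverse.injective (g := fun x => (Ext.mk₀ e.hom).comp x (zero_add k)) ?_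
    intro x
    simp
  exact hf.nontrivial

/-- As r kills N, it acts as zero on Ext(M, N), so the connecting map Extᵏ(M, N) → Extᵏ⁺¹(M/rM, N)
is injective. -/
theorem nontrivial_ext_quotient (M N : ModuleCat.{w} R) (rs : List R)
    (reg : IsWeaklyRegular M rs) (hN : ∀ r ∈ rs, ∀ n : N, r • n = 0) (k : ℕ)
    (h : Nontrivial (Ext M N k)) :
    Nontrivial (Ext (ModuleCat.of R (M ⧸ Ideal.ofList rs • (⊤ : Submodule R M))) N
      (k + rs.length)) := by
  induction rs generalizing M k with
  | nil =>
    have e : (M ⧸ Ideal.ofList ([] : List R) • (⊤ : Submodule R M)) ≃ₗ[R] M :=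
      Submodule.quotEquivOfEqBot _ (by rw [Ideal.ofList_nil, Submodule.bot_smul])
    exact nontrivial_ext_of_iso e.symm.toModuleIso N k h
  | cons r rs ih =>
    rw [isWeaklyRegular_cons_iff] at reg
    have h₁ : Nontrivial (Ext (ModuleCat.of R (QuotSMulTop r M)) N (k + 1)) := by
      by_contra hn
      rw [not_nontrivial_iff_subsingleton] at hn
      have hS := reg.1.smulShortComplex_shortExact (M := M)
      have : Subsingleton (Ext (M.smulShortComplex r).X₃ N (k + 1)) := hn
      obtain ⟨e, he⟩ := exists_ne (0 : Ext M N k)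
      obtain ⟨e', he'⟩ := Ext.contravariant_sequence_exact₁ hS N e (add_comm 1 k)
        (Subsingleton.elim _ _)
      have hr : r • 𝟙 N = 0 := by
        ext n
        exact hN r List.mem_cons_self n
      have hzero : ∀ z : Ext M N k, (Ext.mk₀ (r • 𝟙 M)).comp z (zero_add k) = 0 := fun z => by
        rw [Ext.mk₀_smul, Ext.smul_comp, Ext.mk₀_id_comp, Ext.smul_eq_comp_mk₀, hr, Ext.mk₀_zero,
          Ext.comp_zero]
      exact he (he'.symm.trans (hzero e'))
    have h₂ := ih (ModuleCat.of R (QuotSMulTop r M)) reg.2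
      (fun s hs => hN s (List.mem_cons_of_mem _ hs)) (k + 1) h₁
    rw [List.length_cons, ← Nat.add_assoc, Nat.add_right_comm]
    exact nontrivial_ext_of_iso
      (Submodule.quotOfListConsSMulTopEquivQuotSMulTopInner M r rs).symm.toModuleIso N _ h₂

end RegularSequence

/-! ### Restriction of scalars along a free extension. -/

section Restriction

open CategoryTheory Module

variable {R : Type u} {S : Type v} [CommRing R] [Ring S] [Algebra R S] [Module.Free R S]

variable (R S) in
theorem projective_of_isScalarTower (M : Type w) [AddCommGroup M] [Module R M] [Module S M]
    [IsScalarTower R S M] [Module.Projective S M] : Module.Projective R M := by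
  obtain ⟨s, hs⟩ := Module.projective_def'.1 (inferInstance : Module.Projective S M)
  exact Module.Projective.of_split (s.restrictScalars R)
    ((Finsupp.linearCombination S id).restrictScalars R)
    (LinearMap.ext fun m => LinearMap.congr_fun hs m)

/-- Restriction is exact and, S being free over R, preserves projectives; hence induction on
syzygies. -/
theorem hasProjectiveDimensionLE_restrictScalars [Small.{w} R] [Small.{w} S] (M : ModuleCat.{w} S)
    (n : ℕ) [h : HasProjectiveDimensionLE M n] :
    HasProjectiveDimensionLE ((ModuleCat.restrictScalars (algebraMap R S)).obj M) n := by
  have key : ∀ M : ModuleCat.{w} S, Projective M →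
      Projective ((ModuleCat.restrictScalars (algebraMap R S)).obj M) := fun M hM => by
    have : Module.Projective S M := (IsProjective.iff_projective M).2 hM
    let : Module R M := Module.compHom M (algebraMap R S)
    have : IsScalarTower R S M := ⟨fun r s m => by
      rw [Algebra.smul_def, mul_smul]
      rfl⟩
    exact (IsProjective.iff_projective M).1 (projective_of_isScalarTower R S M)
  induction n generalizing M with
  | zero =>
    rw [← projective_iff_hasProjectiveDimensionLE_zero] at h ⊢
    exact key M h
  | succ n ih =>
    have hS := M.shortExact_projectiveShortComplex
    have hex := (ShortComplex.ShortExact.moduleCat_exact_iff_function_exact _).1 hS.exact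
    have hS' : (M.projectiveShortComplex.map
        (ModuleCat.restrictScalars.{w} (algebraMap R S))).ShortExact :=
      ModuleCat.shortComplex_shortExact _
        (fun x => hex x) hS.moduleCat_injective_f hS.moduleCat_surjective_g
    have h₁ := (hS.hasProjectiveDimensionLT_X₃_iff n inferInstance).1 h
    exact (hS'.hasProjectiveDimensionLT_X₃_iff n (key _ inferInstance)).2 (ih _)

end Restriction

end LieCohomologicalDimension

/-! ### The trivial module over a polynomial ring. -/

namespace LieCohomologicalDimension

open CategoryTheory Abelian Module RingTheory.Sequence MvPolynomial

section Polynomial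

variable {K : Type u} [Field K] {σ : Type v}

/-- Membership in an ideal generated by variables is read off each monomial, and multiplying by a
different variable leaves the relevant exponents unchanged. -/
theorem isWeaklyRegular_X (l : List σ) (hl : l.Nodup) :
    IsWeaklyRegular (MvPolynomial σ K) (l.map (X : σ → MvPolynomial σ K)) where
  regular_mod_prev i hi := by
    have hi' : i < l.length := by simpa using hi
    have hspan : (Ideal.ofList ((l.map (X : σ → MvPolynomial σ K)).take i) •
        (⊤ : Submodule (MvPolynomial σ K) (MvPolynomial σ K))) =
        Ideal.span (X '' {k | k ∈ l.take i}) := by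
      rw [smul_eq_mul, Ideal.mul_top, Ideal.ofList, ← List.map_take]
      congr 1
      ext f
      simp only [List.mem_map, Set.mem_ofPred, Set.mem_image]
    rw [hspan, isSMulRegular_quotient_iff_mem_of_smul_mem]
    intro f hf
    rw [List.getElem_map, smul_eq_mul, mem_ideal_span_X_image] at hf
    rw [mem_ideal_span_X_image]
    intro m hm
    obtain ⟨k, hk, hmk⟩ := hf (m + Finsupp.single l[i] 1) (by
      rw [MvPolynomial.mem_support_iff, add_comm, coeff_X_mul]
      exact MvPolynomial.mem_support_iff.1 hm)
    refine ⟨k, hk, ?_⟩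
    have hne : l[i] ≠ k := by
      rintro rfl
      obtain ⟨j, hj, hj'⟩ := List.mem_take_iff_getElem.1 hk
      have := (hl.getElem_inj_iff).1 hj'
      lia
    rwa [Finsupp.add_apply, Finsupp.single_eq_of_ne hne.symm, add_zero] at hmk

variable (K σ) in
theorem constantCoeff_surjective :
    Function.Surjective (constantCoeff : MvPolynomial σ K →+* K) := fun c =>
  ⟨C c, constantCoeff_C σ c⟩

theorem ker_toScalarModule_constantCoeff [Fintype σ] :
    Ideal.ofList ((Finset.univ.toList).map (X : σ → MvPolynomial σ K)) •
      (⊤ : Submodule (MvPolynomial σ K) (MvPolynomial σ K)) =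
    LinearMap.ker (toScalarModule.{u, v} (constantCoeff : MvPolynomial σ K →+* K)) := by
  have hspan : Ideal.ofList ((Finset.univ.toList).map (X : σ → MvPolynomial σ K)) •
      (⊤ : Submodule (MvPolynomial σ K) (MvPolynomial σ K)) =
      Ideal.span (X '' Set.univ) := by
    rw [smul_eq_mul, Ideal.mul_top, Ideal.ofList]
    congr 1
    ext f
    simp
  rw [hspan]
  ext f
  rw [mem_ideal_span_X_image, LinearMap.mem_ker, toScalarModule_eq_zero_iff, constantCoeff_eq]
  refine ⟨fun h => ?_, fun h m hm => ?_⟩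
  · by_contra h₀
    obtain ⟨i, -, hi⟩ := h 0 (MvPolynomial.mem_support_iff.2 h₀)
    exact hi rfl
  · by_contra! h'
    have hm₀ : m = 0 := Finsupp.ext fun i => h' i trivial
    rw [hm₀] at hm
    exact MvPolynomial.mem_support_iff.1 hm h

/-- The quotient of a polynomial ring by all its variables. -/
noncomputable def quotientIso [Fintype σ] :
    ModuleCat.of (MvPolynomial σ K) (MvPolynomial σ K ⧸
      Ideal.ofList ((Finset.univ.toList).map (X : σ → MvPolynomial σ K)) •
        (⊤ : Submodule (MvPolynomial σ K) (MvPolynomial σ K))) ≅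
    scalarModule.{u, v} (constantCoeff : MvPolynomial σ K →+* K) :=
  ((Submodule.quotEquivOfEq _ _ ker_toScalarModule_constantCoeff).trans
    ((toScalarModule.{u, v} (constantCoeff : MvPolynomial σ K →+* K)).quotKerEquivOfSurjective
      fun m => by
        obtain ⟨r, hr⟩ := constantCoeff_surjective K σ (ULift.down m)
        exact ⟨r, ULift.ext _ _ hr⟩)).toModuleIso

/-- K is the quotient of the free module R by the regular sequence of variables. The nonzero
augmentation in Hom(R, K) is carried to a nonzero class in Extⁿ(K, K), n being the number of
variables. -/
theorem projectiveDimension_constantCoeff [Fintype σ] :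
    projectiveDimension (scalarModule.{u, v} (constantCoeff : MvPolynomial σ K →+* K)) =
      Fintype.card σ := by
  have reg := isWeaklyRegular_X (K := K) (Finset.univ : Finset σ).toList (Finset.nodup_toList _)
  have hlen : ((Finset.univ : Finset σ).toList.map (X : σ → MvPolynomial σ K)).length =
      Fintype.card σ := by
    rw [List.length_map, Finset.length_toList, Finset.card_univ]
  have hproj : Projective (ModuleCat.of (MvPolynomial σ K) (MvPolynomial σ K)) :=
    ModuleCat.projective_of_free (Basis.singleton Unit (MvPolynomial σ K))
  refine le_antisymm ?_ ?_
  · rw [projectiveDimension_le_iff]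
    have h := hasProjectiveDimensionLT_quotient
      (ModuleCat.of (MvPolynomial σ K) (MvPolynomial σ K)) _ reg 0 inferInstance
    rw [hlen, zero_add, add_comm] at h
    exact hasProjectiveDimensionLT_of_iso quotientIso _
  · rw [projectiveDimension_ge_iff]
    intro h
    have h₀ : Nontrivial (Ext (ModuleCat.of (MvPolynomial σ K) (MvPolynomial σ K))
        (scalarModule.{u, v} (constantCoeff : MvPolynomial σ K →+* K)) 0) := by
      let φ : ModuleCat.of (MvPolynomial σ K) (MvPolynomial σ K) ⟶
          scalarModule.{u, v} (constantCoeff : MvPolynomial σ K →+* K) :=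
        (toScalarModule.{u, v} (constantCoeff : MvPolynomial σ K →+* K)).shortComplexKer.g
      refine ⟨Ext.mk₀ φ, 0, fun h => ?_⟩
      rw [← Ext.mk₀_zero, (Ext.mk₀_bijective _ _).1.eq_iff] at h
      have h₁ := congrArg (fun g => g.hom (1 : MvPolynomial σ K)) h
      exact one_ne_zero ((map_one _).symm.trans ((toScalarModule_eq_zero_iff
        (constantCoeff : MvPolynomial σ K →+* K) 1).1 h₁))
    have h₁ := nontrivial_ext_quotient _ _ _ reg (fun r hr m => ?_) 0 h₀
    · have h₂ := nontrivial_ext_of_iso quotientIso _ _ h₁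
      rw [hlen, zero_add] at h₂
      exact not_subsingleton _ (HasProjectiveDimensionLT.subsingleton
        (scalarModule.{u, v} (constantCoeff : MvPolynomial σ K →+* K)) (Fintype.card σ) _ le_rfl
        (scalarModule.{u, v} (constantCoeff : MvPolynomial σ K →+* K)))
    · obtain ⟨i, -, rfl⟩ := List.mem_map.1 hr
      refine ULift.ext _ _ ?_
      change constantCoeff (X i : MvPolynomial σ K) * (ULift.down m) = 0
      rw [constantCoeff_X, zero_mul]

theorem projectiveDimension_constantCoeff_of_infinite [Infinite σ] :
    projectiveDimension (scalarModule.{u, v} (constantCoeff : MvPolynomial σ K →+* K)) = ⊤ := by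
  by_contra hne
  obtain ⟨n, hn⟩ := (projectiveDimension_ne_top_iff _).1 hne
  obtain ⟨f⟩ : Nonempty (ULift.{v} (Fin (n + 1)) ↪ σ) :=
    ⟨Equiv.ulift.toEmbedding.trans (Fin.valEmbedding.trans (Infinite.natEmbedding σ))⟩
  classical
  -- With n + 1 variables moved into the coefficients, the ring is free over a polynomial ring whose
  -- trivial module has dimension n + 1.
  let e : σ ≃ ((Set.range f)ᶜ : Set σ) ⊕ ULift.{v} (Fin (n + 1)) :=
    ((Equiv.Set.sumCompl (Set.range f)).symm.trans (Equiv.sumComm _ _)).trans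
      (Equiv.sumCongr (Equiv.refl _) (Equiv.ofInjective f f.injective).symm)
  let g : MvPolynomial σ K ≃ₐ[K]
      MvPolynomial ((Set.range f)ᶜ : Set σ) (MvPolynomial (ULift.{v} (Fin (n + 1))) K) :=
    (renameEquiv K e).trans (sumAlgEquiv K _ _)
  let ε : MvPolynomial ((Set.range f)ᶜ : Set σ) (MvPolynomial (ULift.{v} (Fin (n + 1))) K) →+* K :=
    constantCoeff.comp constantCoeff
  have hε : ∀ p, ε (g p) = constantCoeff p := fun p => by
    induction p using MvPolynomial.induction_on with
    | C a => simp [g, ε]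
    | add p q hp hq => rw [map_add, map_add, hp, hq, map_add]
    | mul_X p i hp =>
      rw [map_mul, map_mul, hp, map_mul, constantCoeff_X, mul_zero]
      have hX : ε (g (X i)) = 0 := by
        change constantCoeff (constantCoeff (sumAlgEquiv K _ _ (rename e (X i)))) = 0
        rw [rename_X]
        cases e i with
        | inl k => rw [sumAlgEquiv_X_inl, constantCoeff_X, map_zero]
        | inr k => rw [sumAlgEquiv_X_inr, constantCoeff_C, constantCoeff_X]
      rw [hX, mul_zero]
  have h₁ := projectiveDimension_scalarModule_eq.{u, v} g.toRingEquiv constantCoeff ε hε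
  have h₂ : HasProjectiveDimensionLE (scalarModule.{u, v} ε) n := by
    rwa [← projectiveDimension_le_iff, ← h₁, projectiveDimension_le_iff]
  have h₃ := hasProjectiveDimensionLE_restrictScalars
    (R := MvPolynomial (ULift.{v} (Fin (n + 1))) K) (scalarModule.{u, v} ε) n
  let e' : (ModuleCat.restrictScalars (algebraMap (MvPolynomial (ULift.{v} (Fin (n + 1))) K)
      (MvPolynomial ((Set.range f)ᶜ : Set σ) (MvPolynomial (ULift.{v} (Fin (n + 1))) K)))).obj
        (scalarModule.{u, v} ε) ≃ₗ[MvPolynomial (ULift.{v} (Fin (n + 1))) K]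
      scalarModule.{u, v} (constantCoeff : MvPolynomial (ULift.{v} (Fin (n + 1))) K →+* K) :=
    { AddEquiv.refl (ULift.{v} K) with
      map_smul' := fun r m => ULift.ext _ _ (by
        change ε (C r) * m.down = constantCoeff r * m.down
        rw [RingHom.comp_apply, constantCoeff_C]) }
  have h₄ := (projectiveDimension_le_iff _ n).2 (hasProjectiveDimensionLT_of_iso e'.toModuleIso _)
  rw [projectiveDimension_constantCoeff] at h₄
  have h₅ : n + 1 ≤ n := by
    rw [Fintype.card_ulift, Fintype.card_fin] at h₄
    exact_mod_cast h₄
  lia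

end Polynomial

/-! ### Abelian Lie algebras. -/

section Abelian

attribute [local instance] LieRing.ofAssociativeRing

open UniversalEnvelopingAlgebra PoincareBirkhoffWitt

variable {K : Type u} {L : Type v} [Field K] [LieRing L] [LieAlgebra K L] [IsLieAbelian L]

theorem enveloping_mul_comm (u v : UniversalEnvelopingAlgebra K L) : u * v = v * u := by
  have h : ∀ x (v : UniversalEnvelopingAlgebra K L), Commute (ι K x) v := fun x v => by
    induction v using enveloping_induction with
    | ι y =>
      rw [commute_iff_eq, ← sub_eq_zero, ← LieRing.of_associative_ring_bracket, ← LieHom.map_lie,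
        trivial_lie_zero, map_zero]
    | algebraMap c => exact (Algebra.commutes c _).symm
    | add v w hv hw => exact hv.add_right hw
    | mul v w hv hw => exact hv.mul_right hw
  change Commute u v
  induction u using enveloping_induction with
  | ι x => exact h x v
  | algebraMap c => exact Algebra.commutes c _
  | add u w hu hw => exact hu.add_left hw
  | mul u w hu hw => exact hu.mul_left hw

/-- The enveloping algebra of an abelian Lie algebra maps to the polynomials in a basis. -/
noncomputable def toPolynomial {σ : Type w} (b : Basis σ K L) :
    UniversalEnvelopingAlgebra K L →ₐ[K] MvPolynomial σ K :=
  lift K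
    { b.constr K (X : σ → MvPolynomial σ K) with
      map_lie' := fun {x y} => by
        simp only [trivial_lie_zero, LieRing.of_associative_ring_bracket, mul_comm, sub_self]
        exact map_zero (b.constr K (X : σ → MvPolynomial σ K)) }

theorem toPolynomial_ι {σ : Type w} (b : Basis σ K L) (i : σ) :
    toPolynomial b (ι K (b i)) = X i := by
  rw [toPolynomial, lift_ι_apply]
  exact b.constr_basis K _ i

/-- Both rings are the free commutative algebra on L; their universal properties give inverse maps,
without Poincaré–Birkhoff–Witt. -/
theorem exists_ringEquiv_mvPolynomial {σ : Type w} (b : Basis σ K L) :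
    ∃ e : UniversalEnvelopingAlgebra K L ≃+* MvPolynomial σ K,
      ∀ u, constantCoeff (e u) = augmentation K L u := by
  let : CommRing (UniversalEnvelopingAlgebra K L) :=
    { (inferInstance : Ring (UniversalEnvelopingAlgebra K L)) with
      mul_comm := enveloping_mul_comm }
  let g : MvPolynomial σ K →ₐ[K] UniversalEnvelopingAlgebra K L := aeval fun i => ι K (b i)
  have h₁ : ∀ u, g (toPolynomial b u) = u := fun u => by
    induction u using enveloping_induction with
    | ι x =>
      induction x using basis_induction b with
      | basis i => rw [toPolynomial_ι, aeval_X]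
      | zero => simp only [map_zero]
      | add x y hx hy => simp only [map_add, hx, hy]
      | smul c x hx => simp only [map_smul, hx]
    | algebraMap c => rw [AlgHom.commutes, AlgHom.commutes]
    | add u v hu hv => rw [map_add, map_add, hu, hv]
    | mul u v hu hv => rw [map_mul, map_mul, hu, hv]
  have h₂ : ∀ p, toPolynomial b (g p) = p := fun p => by
    induction p using MvPolynomial.induction_on with
    | C a => exact (congrArg _ (AlgHom.commutes g a)).trans (AlgHom.commutes _ a)
    | add p q hp hq => rw [map_add, map_add, hp, hq]
    | mul_X p i hp => rw [map_mul, map_mul, hp, aeval_X, toPolynomial_ι]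
  refine ⟨{ (toPolynomial b).toRingHom with
    invFun := g
    left_inv := h₁
    right_inv := h₂ }, fun u => ?_⟩
  change constantCoeff (toPolynomial b u) = augmentation K L u
  induction u using enveloping_induction with
  | ι x =>
    rw [augmentation_ι]
    induction x using basis_induction b with
    | basis i => rw [toPolynomial_ι, constantCoeff_X]
    | zero => simp only [map_zero]
    | add x y hx hy => simp only [map_add, hx, hy, add_zero]
    | smul c x hx => rw [map_smul, map_smul, smul_eq_C_mul, map_mul, hx, mul_zero]
  | algebraMap c => rw [AlgHom.commutes, AlgHom.commutes]; exact constantCoeff_C σ c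
  | add u v hu hv => simp only [map_add, hu, hv]
  | mul u v hu hv => simp only [map_mul, hu, hv]

theorem cd_eq_rank : cd K L = ((Cardinal.toENat (Module.rank K L) : ℕ∞) : WithBot ℕ∞) := by
  let b := Basis.ofVectorSpace K L
  obtain ⟨e, he⟩ := exists_ringEquiv_mvPolynomial b
  rw [cd_eq_projectiveDimension, projectiveDimension_scalarModule_eq.{u, v} e _ constantCoeff he,
    ← b.mk_eq_rank'']
  cases finite_or_infinite (Basis.ofVectorSpaceIndex K L) with
  | inl h =>
    have := Fintype.ofFinite (Basis.ofVectorSpaceIndex K L)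
    rw [projectiveDimension_constantCoeff, Cardinal.mk_fintype, map_natCast]
    rfl
  | inr h =>
    rw [projectiveDimension_constantCoeff_of_infinite,
      Cardinal.toENat_eq_top.2 (Cardinal.aleph0_le_mk _)]
    rfl

end Abelian

end LieCohomologicalDimension

theorem mainTheorem10 (K : Type u) [Field K] :
    -- an abelian Lie algebra, of finite or infinite dimension
    (∀ (L : Type v) [LieRing L] [LieAlgebra K L] [IsLieAbelian L],
      LieCohomologicalDimension.cd K L =
        ((Cardinal.toENat (Module.rank K L) : ℕ∞) : WithBot ℕ∞)) ∧
    -- the two-dimensional nonabelian Lie algebra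
    (∀ (L : Type v) [LieRing L] [LieAlgebra K L],
      Module.finrank K L = 2 → ¬ IsLieAbelian L →
        LieCohomologicalDimension.cd K L = 2) ∧
    -- Lie algebras of cohomological dimension one
    (∀ (L : Type v) [LieRing L] [LieAlgebra K L],
      LieCohomologicalDimension.cd K L = 1 →
        ¬ ∃ S : LieSubalgebra K L, Module.finrank K S = 2) := by
  refine ⟨fun L _ _ _ => LieCohomologicalDimension.cd_eq_rank,
    fun L _ _ h _ => LieCohomologicalDimension.cd_eq_two_of_finrank_eq_two h,
    fun L _ _ h ⟨S, hS⟩ => ?_⟩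
  have h₁ := LieCohomologicalDimension.two_le_cd_of_lieSubalgebra S hS
  rw [h] at h₁
  exact absurd h₁ (by decide)
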